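/- Let $n\ge 1$. A prior $\theta$ is a probability distribution over a finite set $\{F^1,\dots,F^m\}$ ($m\ge 1$) of finitely supported probability distributions on $[0,\infty)$. In the i.i.d. problem with prior $\theta$, nature draws $F$ according to $\theta$ and then draws $X_1,\dots,X_n$ independently from $F$; the gambler knows $\theta$ but not $F$. A stopping rule is a family of functions $r_1,\dots,r_n$, where $r_i(x_1,\dots,x_i,\theta)\in[0,1]$ is the probability of stopping at $X_i$ given the observed values $x_1,\dots,x_i$, the prior $\theta$, and that the rule has not stopped earlier. Its stopping time $\tau\in\{1,\dots,n\}\cup\{\infty\}$ satisfies $$\Pr[\tau=i\mid X_1=x_1,\dots,X_n=x_n,\theta]=\Bigl(\prod_{j=1}^{i-1}\bigl(1-r_j(x_1,\dots,x_j,\theta)\bigr)\Bigr)\, r_i(x_1,\dots,x_i,\theta)$$ for $1\le i\le n$, and is $\infty$ with the remaining probability; by convention $X_\infty=0$. Theorem. For every $\delta>0$ there exists $n_0\in\mathbb{N}$ such that for every $n\ge n_0$ there exist finitely many finitely supported distributions $F^1,\dots,F^m$ on $[0,\infty)$ and a distribution $\theta$ over $\{F^1,\dots,F^m\}$ such that $\mathbb{E}[\max\{X_1,\dots,X_n\}]>0$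 and, for every stopping rule, with stopping time $\tau$, $$\mathbb{E}[X_\tau]\le\Bigl(\frac1e+\delta\Bigr)\cdot\mathbb{E}[\max\{X_1,\dots,X_n\}].$$ Both expectations are over the draw of $F$ from $\theta$, the values $X_1,\dots,X_n$, and the randomness of the rule. -/

import Mathlib

open scoped NNReal ENNReal

namespace Prophet

noncomputable section

/-- The prior distributions `θ`: finite distributions over finitely supported distributions on the
non-negative reals. The candidates `F^1, …, F^m` are the elements of the support of `θ`. -/
abbrev Prior : Type :=
  {θ : PMF (PMF ℝ≥0) // θ.support.Finite ∧ ∀ F ∈ θ.support, F.support.Finite}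

/-- A (randomized) stopping rule for `n` values in the problem with a prior. With indices counted
from `0`, `r i x θ` is the probability of stopping at time `i`, given the values `x 0, …, x i`
observed so far, the prior `θ`, and that the rule has not stopped before. The rule is not shown the
distribution that was drawn from `θ`. -/
abbrev StoppingRule (n : ℕ) : Type :=
  (i : Fin n) → (Fin (i + 1) → ℝ≥0) → Prior → unitInterval

/-- The values `x 0, …, x i` observed up to and including time `i`. -/
def observed {n : ℕ} (x : Fin n → ℝ≥0) (i : Fin n) : Fin (i + 1) → ℝ≥0 :=
  fun j => x (Fin.castLE i.isLt j)

/-- The probability of stopping at time `i` on the sequence `x`, given no earlier stop. -/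
def StoppingRule.stopProb {n : ℕ} (r : StoppingRule n) (θ : Prior) (x : Fin n → ℝ≥0)
    (i : Fin n) : ℝ :=
  (r i (observed x i) θ : ℝ)

/-- The conditional probability of `τ = i` given the sequence `x`; the value `⊤` stands for
`τ = ∞`, that is, for never stopping. -/
def StoppingRule.timeWeight {n : ℕ} (r : StoppingRule n) (θ : Prior) (x : Fin n → ℝ≥0) :
    WithTop (Fin n) → ℝ
  | (i : Fin n) => (∏ j ∈ Finset.univ.filter (· < i), (1 - r.stopProb θ x j)) * r.stopProb θ x i
  | ⊤ => ∏ j, (1 - r.stopProb θ x j)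

theorem StoppingRule.timeWeight_nonneg {n : ℕ} (r : StoppingRule n) (θ : Prior)
    (x : Fin n → ℝ≥0) (t : WithTop (Fin n)) : 0 ≤ r.timeWeight θ x t := by
  have h0 : ∀ j, 0 ≤ r.stopProb θ x j := fun j => (r j (observed x j) θ).2.1
  have h1 : ∀ j, 0 ≤ 1 - r.stopProb θ x j := fun j => sub_nonneg.2 (r j (observed x j) θ).2.2
  cases t with
  | top => exact Finset.prod_nonneg fun j _ => h1 j
  | coe i => exact mul_nonneg (Finset.prod_nonneg fun j _ => h1 j) (h0 i)

theorem StoppingRule.sum_timeWeight {n : ℕ} (r : StoppingRule n) (θ : Prior)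
    (x : Fin n → ℝ≥0) : ∑ t, r.timeWeight θ x t = 1 := by
  have h := Finset.prod_one_sub_ordered (Finset.univ : Finset (Fin n)) (r.stopProb θ x)
  have h2 : ∑ t, r.timeWeight θ x t = r.timeWeight θ x ⊤ + ∑ i : Fin n, r.timeWeight θ x i :=
    Fintype.sum_option (r.timeWeight θ x)
  rw [h2]
  simp only [StoppingRule.timeWeight]
  rw [h, ← eq_sub_iff_add_eq']
  simp [mul_comm]

/-- The conditional law of the stopping time `τ` of the rule `r`, given the sequence `x`. -/
def StoppingRule.timeLaw {n : ℕ} (r : StoppingRule n) (θ : Prior) (x : Fin n → ℝ≥0) :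
    PMF (WithTop (Fin n)) :=
  PMF.ofFintype (fun t => ENNReal.ofReal (r.timeWeight θ x t)) (by
    rw [← ENNReal.ofReal_sum_of_nonneg fun t _ => r.timeWeight_nonneg θ x t,
      r.sum_timeWeight, ENNReal.ofReal_one])

theorem tsum_prod_pmf (F : PMF ℝ≥0) (n : ℕ) : ∑' x : Fin n → ℝ≥0, ∏ i, F (x i) = 1 := by
  induction n with
  | zero => simp
  | succ n ih =>
    rw [← (Fin.consEquiv fun _ : Fin (n + 1) => ℝ≥0).tsum_eq]
    simp only [Fin.consEquiv, Equiv.coe_fn_mk, Fin.prod_univ_succ, Fin.cons_zero, Fin.cons_succ]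
    rw [ENNReal.tsum_prod']
    simp [ENNReal.tsum_mul_left, ih, F.tsum_coe]

/-- The law of `n` independent draws from `F`. -/
def iid (F : PMF ℝ≥0) (n : ℕ) : PMF (Fin n → ℝ≥0) :=
  ⟨fun x => ∏ i, F (x i), (tsum_prod_pmf F n) ▸ ENNReal.summable.hasSum⟩

theorem iid_apply (F : PMF ℝ≥0) (n : ℕ) (x : Fin n → ℝ≥0) : iid F n x = ∏ i, F (x i) :=
  rfl

/-- The law of `(X_1, …, X_n)` when `F` is drawn from `θ` and the values are then drawn
independently from `F`. -/
def Prior.valueLaw (θ : Prior) (n : ℕ) : PMF (Fin n → ℝ≥0) :=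
  θ.1.bind fun F => iid F n

/-- The joint law of the values `(X_1, …, X_n)` and of the stopping time `τ` of the rule `r`. -/
def Prior.jointLaw (θ : Prior) {n : ℕ} (r : StoppingRule n) :
    PMF ((Fin n → ℝ≥0) × WithTop (Fin n)) :=
  (θ.valueLaw n).bind fun x => (r.timeLaw θ x).map fun t => (x, t)

/-- The expectation of a non-negative function of an outcome with law `P`. -/
def expect {Ω : Type} (P : PMF Ω) (f : Ω → ℝ≥0) : ℝ≥0∞ :=
  ∑' ω, P ω * (f ω : ℝ≥0∞)

/-- The reward `x_τ`, with the convention `x_∞ = 0`. -/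
def reward {n : ℕ} (x : Fin n → ℝ≥0) : WithTop (Fin n) → ℝ≥0
  | (i : Fin n) => x i
  | ⊤ => 0

/-- The gambler's expected reward `E[X_τ]`. -/
def expectedReward (θ : Prior) {n : ℕ} (r : StoppingRule n) : ℝ≥0∞ :=
  expect (θ.jointLaw r) fun ω => reward ω.1 ω.2

/-- The prophet's expected reward `E[max{X_1, …, X_n}]`. -/
def expectedMax (θ : Prior) (n : ℕ) : ℝ≥0∞ :=
  expect (θ.valueLaw n) fun x => Finset.univ.sup x

end

end Prophet

namespace Prophet

/-! The hard prior hides the scale. A scale `k` in `{1, …, K}` is drawn with probability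
proportional to `1 / (k b ^ k)`. Each value is then `b ^ k` with probability `ε = η / n`, and
otherwise `b ^ a` with `a` uniform below `k`, where `b = 1 / η ^ 2`. Smaller values are negligible
against `b ^ k`, and two copies of `b ^ k` are rare, so the gambler gains essentially only by
stopping at the first `b ^ k` (`wsum_spike_reward_le`).

At that moment the exponents seen are a record `k` preceded by uniform draws below `k`. A record `m
< k` arising under scale `k` has the same conditional law of its past (`wsum_record`), so the rule
cannot tell it from a true spike. One family `A i k` of acceptance probabilities therefore governs
all scales. Since the rule stops at most once, `acceptance_add_sum_le` bounds `A i k` plus the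
acceptances of earlier, smaller records by `1`.

Averaging over `k` with weights `1 / k` gives `a i + ∑ j < i, a j / (j + 1) ≤ H + 2 n` for `a i = ∑
k, A i k / k`, with `H` the harmonic sum (`sum_acceptance_le`). This is the secretary linear
program, and the dual solution `max 0 (1 + log (i / n))` bounds `∑ a i` by about `H n / e`
(`secretary_lp_bound`). Up to a common factor the prophet earns about `H η` and the gambler at most
about `(η / n) (H n / e)`. The errors vanish for small `η`, large `n`, and then `H` large against `n
/ η`. -/

/-! ### Lower bounds for power sums. -/

theorem sum_Ioc_one_div_pow_ge (j m K : ℕ) (hK : m ≤ K) :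
    (1 / ((m : ℝ) + 1) ^ (j + 1) - 1 / ((K : ℝ) + 1) ^ (j + 1)) / (j + 1) ≤
      ∑ k ∈ Finset.Ioc m K, 1 / (k : ℝ) ^ (j + 2) := by
  induction K, hK using Nat.le_induction with
  | base => simp
  | succ K hK ih =>
    rw [Finset.sum_Ioc_succ_top (by omega)]
    -- The left side is the integral of `x ^ (-(j + 2))` over `[K + 1, K + 2]`; Bernoulli's
    -- inequality replaces the integral comparison.
    have key : (1 / ((K : ℝ) + 1) ^ (j + 1) - 1 / ((K : ℝ) + 1 + 1) ^ (j + 1)) / (j + 1) ≤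
        1 / ((K : ℝ) + 1) ^ (j + 2) := by
      have hb := one_add_mul_le_pow (a := -(1 / ((K : ℝ) + 2)))
        (by
          have : 1 / ((K : ℝ) + 2) ≤ 1 := by rw [div_le_one (by positivity)]; linarith
          linarith) (j + 1)
      have e1 : 1 + -(1 / ((K : ℝ) + 2)) = (K + 1) / (K + 2) := by field_simp; ring
      rw [e1, div_pow] at hb
      have h2 : ((j : ℝ) + 1) * (1 / ((K : ℝ) + 2)) ≤ (j + 1) * (1 / (K + 1)) := by
        gcongr; norm_num
      have h3 : 1 - ((K : ℝ) + 1) ^ (j + 1) / (K + 2) ^ (j + 1) ≤ (j + 1) * (1 / (K + 1)) := by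
        push_cast at hb; linarith
      rw [div_le_iff₀ (by positivity)]
      have e2 : (1 / ((K : ℝ) + 1) ^ (j + 1) - 1 / ((K : ℝ) + 1 + 1) ^ (j + 1)) =
          (1 - ((K : ℝ) + 1) ^ (j + 1) / (K + 2) ^ (j + 1)) * (1 / (K + 1) ^ (j + 1)) := by
        field_simp; ring
      have e3 : 1 / ((K : ℝ) + 1) ^ (j + 2) * (j + 1) =
          ((j + 1) * (1 / (K + 1))) * (1 / (K + 1) ^ (j + 1)) := by
        field_simp
        ring
      rw [e2, e3]
      gcongr
    have e : (1 / ((m : ℝ) + 1) ^ (j + 1) - 1 / (((K + 1 : ℕ) : ℝ) + 1) ^ (j + 1)) / (j + 1) =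
        (1 / ((m : ℝ) + 1) ^ (j + 1) - 1 / ((K : ℝ) + 1) ^ (j + 1)) / (j + 1) +
        (1 / ((K : ℝ) + 1) ^ (j + 1) - 1 / ((K : ℝ) + 1 + 1) ^ (j + 1)) / (j + 1) := by
      push_cast; ring
    rw [e]
    push_cast
    linarith

/-- The main term `1 / ((j + 1) m)` is the source of the coefficient `1 / (j + 1)` in the secretary
program. The first error comes from starting the integral at `m + 1` instead of `m`, the second from
truncating at `K`; summed over `m ≤ K` they stay bounded. -/
theorem pow_mul_sum_Ioc_ge (j m K : ℕ) (hm : 1 ≤ m) (hK : m ≤ K) :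
    1 / ((j + 1) * (m : ℝ)) - (1 / (m : ℝ) - 1 / ((m : ℝ) + 1)) - 1 / ((K : ℝ) + 1) ≤
      (m : ℝ) ^ j * ∑ k ∈ Finset.Ioc m K, 1 / (k : ℝ) ^ (j + 2) := by
  have hm0 : (0 : ℝ) < m := by exact_mod_cast hm
  have hmK : (m : ℝ) ≤ K := by exact_mod_cast hK
  have h1 := mul_le_mul_of_nonneg_left (sum_Ioc_one_div_pow_ge j m K hK)
    (pow_nonneg hm0.le j)
  refine le_trans ?_ h1
  have hb := one_add_mul_le_pow (a := -(1 / ((m : ℝ) + 1)))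
    (by
      have : 1 / ((m : ℝ) + 1) ≤ 1 := by rw [div_le_one (by positivity)]; linarith
      linarith) (j + 1)
  have e1 : 1 + -(1 / ((m : ℝ) + 1)) = m / (m + 1) := by field_simp; ring
  rw [e1] at hb
  have e2 : (m : ℝ) ^ j * ((1 / ((m : ℝ) + 1) ^ (j + 1) - 1 / ((K : ℝ) + 1) ^ (j + 1)) / (j + 1))
      = (m / (m + 1)) ^ (j + 1) / ((j + 1) * m) -
        (m / (K + 1)) ^ j * (1 / (K + 1)) * (1 / (j + 1)) := by
    rw [div_pow, div_pow]
    field_simp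
    ring
  rw [e2]
  have h3 : ((m : ℝ) / (K + 1)) ^ j * (1 / (K + 1)) * (1 / (j + 1)) ≤ 1 * (1 / (K + 1)) * 1 := by
    gcongr
    · apply pow_le_one₀ (by positivity)
      rw [div_le_one (by positivity)]; linarith
    · rw [div_le_one (by positivity)]
      have : (0 : ℝ) ≤ j := by positivity
      linarith
  have h4 : (1 + ((j + 1 : ℕ) : ℝ) * -(1 / ((m : ℝ) + 1))) / ((j + 1) * m) ≤
      (m / (m + 1)) ^ (j + 1) / ((j + 1) * m) := by
    gcongr
  have e5 : (1 + ((j + 1 : ℕ) : ℝ) * -(1 / ((m : ℝ) + 1))) / ((j + 1) * m) =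
      1 / ((j + 1) * (m : ℝ)) - (1 / (m : ℝ) - 1 / ((m : ℝ) + 1)) := by
    push_cast
    field_simp
    ring
  linarith

theorem sum_Icc_telescope_le (K : ℕ) :
    ∑ m ∈ Finset.Icc 1 K, ((1 / (m : ℝ) - 1 / ((m : ℝ) + 1)) + 1 / ((K : ℝ) + 1)) ≤ 2 := by
  have h : ∀ N : ℕ, ∑ m ∈ Finset.Icc 1 N, (1 / (m : ℝ) - 1 / ((m : ℝ) + 1)) =
      1 - 1 / ((N : ℝ) + 1) := by
    intro N
    induction N with
    | zero => simp
    | succ N ih =>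
      rw [Finset.sum_Icc_succ_top (by omega), ih]
      push_cast
      ring
  rw [Finset.sum_add_distrib, h]
  simp only [Finset.sum_const, Nat.card_Icc, nsmul_eq_mul]
  have h1 : 0 ≤ 1 / ((K : ℝ) + 1) := by positivity
  have h2 : ((K + 1 - 1 : ℕ) : ℝ) * (1 / ((K : ℝ) + 1)) ≤ 1 := by
    rw [Nat.add_sub_cancel, mul_one_div, div_le_one (by positivity)]
    linarith
  linarith

/-! ### Linear programming duality for the secretary problem. -/

/-- An antiderivative of `s ↦ max 0 (1 + log s)`. -/
noncomputable def dualPotential (s : ℝ) : ℝ :=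
  if s ≤ Real.exp (-1) then -Real.exp (-1) else s * Real.log s

/-- The density of the optimal dual solution of the secretary linear program. -/
noncomputable def dualDensity (s : ℝ) : ℝ := max 0 (1 + Real.log s)

theorem neg_exp_le_mul_log {s : ℝ} (hs : 0 < s) : -Real.exp (-1) ≤ s * Real.log s := by
  have h := Real.add_one_le_exp (-1 - Real.log s)
  rw [Real.exp_sub, Real.exp_log hs, le_div_iff₀ hs] at h
  linarith

theorem mul_log_tangent {a b : ℝ} (ha : 0 < a) (hb : 0 < b) :
    a * Real.log a + (1 + Real.log a) * (b - a) ≤ b * Real.log b := by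
  have h := Real.log_le_sub_one_of_pos (div_pos ha hb)
  rw [Real.log_div ha.ne' hb.ne'] at h
  have := mul_le_mul_of_nonneg_left h hb.le
  rw [mul_sub b (a / b), mul_div_cancel₀ _ hb.ne'] at this
  linarith

theorem one_add_log_nonneg {s : ℝ} (h : Real.exp (-1) ≤ s) : 0 ≤ 1 + Real.log s := by
  have := Real.log_le_log (Real.exp_pos _) h
  rw [Real.log_exp] at this
  linarith

theorem one_add_log_nonpos {s : ℝ} (hs : 0 < s) (h : s ≤ Real.exp (-1)) :
    1 + Real.log s ≤ 0 := by
  have := Real.log_le_log hs h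
  rw [Real.log_exp] at this
  linarith

theorem neg_exp_le_dualPotential {s : ℝ} : -Real.exp (-1) ≤ dualPotential s := by
  unfold dualPotential
  split_ifs with h
  · rfl
  · exact neg_exp_le_mul_log ((Real.exp_pos _).trans (not_le.1 h))

/-- The potential is convex with derivative `dualDensity`: the tangent at a positive point lies
below the graph. -/
theorem dualPotential_tangent {a b : ℝ} (ha : 0 < a) :
    dualPotential a + dualDensity a * (b - a) ≤ dualPotential b := by
  by_cases h : a ≤ Real.exp (-1)
  · have h0 : dualDensity a = 0 := max_eq_left (one_add_log_nonpos ha h)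
    have h1 : dualPotential a = -Real.exp (-1) := if_pos h
    rw [h0, h1]
    linarith [neg_exp_le_dualPotential (s := b)]
  · have hle := (not_le.1 h).le
    have h0 : dualDensity a = 1 + Real.log a := max_eq_right (one_add_log_nonneg hle)
    have h1 : dualPotential a = a * Real.log a := if_neg h
    rw [h0, h1]
    by_cases hb : b ≤ Real.exp (-1)
    · have h2 : dualPotential b = -Real.exp (-1) := if_pos hb
      have h3 := mul_log_tangent ha (Real.exp_pos (-1))
      have h4 : (1 + Real.log a) * (b - a) ≤ (1 + Real.log a) * (Real.exp (-1) - a) := by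
        gcongr
        exact one_add_log_nonneg hle
      rw [Real.log_exp] at h3
      rw [h2]
      linarith
    · have h2 : dualPotential b = b * Real.log b := if_neg hb
      rw [h2]
      exact mul_log_tangent ha ((Real.exp_pos _).trans (not_le.1 hb))

theorem dualPotential_one : dualPotential 1 = 0 := by
  have : ¬ (1 : ℝ) ≤ Real.exp (-1) := by
    rw [not_le, Real.exp_lt_one_iff]; norm_num
  simp [dualPotential, this]

/-- Dual feasibility in the continuous limit: as the potential vanishes at `1`, `-dualPotential s`
is the integral of the density over `[s, 1]`. Equality holds beyond `1 / e`. -/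
theorem le_mul_dualDensity_sub_dualPotential {s : ℝ} (hs : 0 < s) :
    s ≤ s * dualDensity s - dualPotential s := by
  unfold dualDensity dualPotential
  split_ifs with h
  · rw [max_eq_left (one_add_log_nonpos hs h)]; linarith
  · rw [max_eq_right (one_add_log_nonneg (not_le.1 h).le)]; linarith

/-- The density is increasing, so its right-endpoint sum dominates its integral, and the continuous
inequality survives discretization without loss. -/
theorem dual_feasible {n j : ℕ} (hj : 1 ≤ j) (hjn : j ≤ n) :
    (j : ℝ) ≤ j * dualDensity (j / n) + ∑ i ∈ Finset.Ioc j n, dualDensity (i / n) := by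
  have hn : (0 : ℝ) < n := by exact_mod_cast (by omega : 0 < n)
  have hj0 : (0 : ℝ) < j := by exact_mod_cast hj
  have tail : ∀ N, j ≤ N → (n : ℝ) * (dualPotential (N / n) - dualPotential (j / n)) ≤
      ∑ i ∈ Finset.Ioc j N, dualDensity (i / n) := by
    intro N hN
    induction N, hN using Nat.le_induction with
    | base => simp
    | succ N hN ih =>
      rw [Finset.sum_Ioc_succ_top (by omega)]
      have ht := dualPotential_tangent (a := ((N + 1 : ℕ) : ℝ) / n) (b := N / n) (by positivity)
      have e : (N : ℝ) / n - ((N + 1 : ℕ) : ℝ) / n = -(1 / n) := by push_cast; ring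
      rw [e] at ht
      have := mul_le_mul_of_nonneg_left ht hn.le
      have e2 : (n : ℝ) * (dualDensity (((N + 1 : ℕ) : ℝ) / n) * -(1 / n)) =
        -dualDensity (((N + 1 : ℕ) : ℝ) / n) := by field_simp
      rw [mul_add, e2] at this
      linarith
  have h1 := tail n hjn
  rw [div_self hn.ne', dualPotential_one] at h1
  have h2 := mul_le_mul_of_nonneg_left
    (le_mul_dualDensity_sub_dualPotential (s := (j : ℝ) / n) (by positivity)) hn.le
  have e : (n : ℝ) * (j / n * dualDensity (j / n) - dualPotential (j / n)) =
      j * dualDensity (j / n) - n * dualPotential (j / n) := by field_simp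
  rw [e, mul_div_cancel₀ _ hn.ne'] at h2
  linarith

/-- The terms `i < n` form a left-endpoint sum of an increasing density with integral `1 / e`; the
remaining term `i = n` equals `1`. -/
theorem dual_value_le {n : ℕ} (hn : 1 ≤ n) :
    ∑ i ∈ Finset.Icc 1 n, dualDensity (i / n) ≤ n * Real.exp (-1) + 1 := by
  have hn0 : (0 : ℝ) < n := by exact_mod_cast hn
  have head : ∀ N : ℕ, ∑ i ∈ Finset.Ico 1 (N + 1), dualDensity (i / n) ≤
      n * (dualPotential (((N + 1 : ℕ) : ℝ) / n) + Real.exp (-1)) := by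
    intro N
    induction N with
    | zero =>
      simp only [zero_add, Finset.Ico_self, Finset.sum_empty]
      exact mul_nonneg hn0.le (by linarith [neg_exp_le_dualPotential (s := ((1 : ℕ) : ℝ) / n)])
    | succ N ih =>
      rw [Finset.sum_Ico_succ_top (by omega)]
      have ht := dualPotential_tangent (a := ((N + 1 : ℕ) : ℝ) / n)
        (b := ((N + 1 + 1 : ℕ) : ℝ) / n) (by positivity)
      have e : ((N + 1 + 1 : ℕ) : ℝ) / n - ((N + 1 : ℕ) : ℝ) / n = 1 / n := by push_cast; ring
      rw [e] at ht
      have := mul_le_mul_of_nonneg_left ht hn0.le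
      have e2 : (n : ℝ) * (dualDensity (((N + 1 : ℕ) : ℝ) / n) * (1 / n)) =
        dualDensity (((N + 1 : ℕ) : ℝ) / n) := by field_simp
      rw [mul_add, e2] at this
      linarith
  obtain ⟨N, rfl⟩ : ∃ N, n = N + 1 := ⟨n - 1, by omega⟩
  have h1 := head N
  rw [div_self hn0.ne', dualPotential_one] at h1
  rw [Finset.sum_Icc_succ_top (by omega), div_self hn0.ne']
  have e3 : dualDensity 1 = 1 := by simp [dualDensity]
  have e4 : Finset.Icc 1 N = Finset.Ico 1 (N + 1) := by ext; simp
  rw [e3, e4]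
  linarith

/-- Weak duality for the linear program of the secretary problem; times are counted from `0`. -/
theorem secretary_lp_bound {n : ℕ} (hn : 1 ≤ n) (a : ℕ → ℝ) (C : ℝ) (ha : ∀ i, 0 ≤ a i)
    (h : ∀ i < n, a i + ∑ j ∈ Finset.range i, a j / (j + 1) ≤ C) :
    ∑ i ∈ Finset.range n, a i ≤ C * (n * Real.exp (-1) + 1) := by
  have hd : ∀ s, 0 ≤ dualDensity s := fun s => le_max_left _ _
  have hC : 0 ≤ C := by
    have := h 0 hn
    simp only [Finset.range_zero, Finset.sum_empty, add_zero] at this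
    exact (ha 0).trans this
  have shift : ∀ f : ℕ → ℝ, ∀ j, ∑ i ∈ Finset.Ioc (j + 1) n, f i =
      ∑ i ∈ Finset.Ioo j n, f (i + 1) := by
    intro f j
    rw [← Finset.sum_image (s := Finset.Ioo j n) (g := fun i => i + 1) (f := f)
      (by intro x _ y _ hxy; simpa using hxy)]
    congr 1
    ext x
    simp only [Finset.mem_Ioc, Finset.mem_image, Finset.mem_Ioo]
    constructor
    · rintro ⟨h1, h2⟩
      exact ⟨x - 1, by omega, by omega⟩
    · rintro ⟨y, hy, rfl⟩
      omega
  set y : ℕ → ℝ := fun i => dualDensity (((i + 1 : ℕ) : ℝ) / n) with hy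
  -- Dual feasibility for column `j`, scaled by `a j / (j + 1)`. Exchanging the sums afterwards
  -- makes each `y i` multiply the primal constraint `i`.
  have feas : ∀ j ∈ Finset.range n, a j ≤ a j * y j +
      ∑ i ∈ Finset.Ioo j n, y i * (a j / (j + 1)) := by
    intro j hj
    have hj' := Finset.mem_range.1 hj
    have hf := dual_feasible (n := n) (j := j + 1) (by omega) (by omega)
    rw [shift] at hf
    have h0 : 0 ≤ a j / ((j : ℝ) + 1) := div_nonneg (ha j) (by positivity)
    have := mul_le_mul_of_nonneg_left hf h0
    have e1 : a j / ((j : ℝ) + 1) * ((j + 1 : ℕ) : ℝ) = a j := by push_cast; field_simp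
    rw [mul_add, ← mul_assoc, e1, Finset.mul_sum] at this
    refine this.trans_eq ?_
    congr 1
    exact Finset.sum_congr rfl fun i _ => mul_comm _ _
  calc ∑ i ∈ Finset.range n, a i
      ≤ ∑ j ∈ Finset.range n, (a j * y j + ∑ i ∈ Finset.Ioo j n, y i * (a j / (j + 1))) :=
        Finset.sum_le_sum feas
    _ = ∑ i ∈ Finset.range n, y i * (a i + ∑ j ∈ Finset.range i, a j / (j + 1)) := by
        rw [Finset.sum_add_distrib]
        rw [Finset.sum_comm' (s := Finset.range n) (t := fun j => Finset.Ioo j n)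
          (t' := Finset.range n) (s' := fun i => Finset.range i)
          (by intro x y; simp only [Finset.mem_range, Finset.mem_Ioo]; omega)]
        rw [← Finset.sum_add_distrib]
        refine Finset.sum_congr rfl fun i _ => ?_
        rw [mul_add, Finset.mul_sum, mul_comm (a i)]
    _ ≤ ∑ i ∈ Finset.range n, y i * C :=
        Finset.sum_le_sum fun i hi =>
          mul_le_mul_of_nonneg_left (h i (Finset.mem_range.1 hi)) (hd _)
    _ = C * ∑ i ∈ Finset.range n, y i := by rw [← Finset.sum_mul, mul_comm]
    _ ≤ C * (n * Real.exp (-1) + 1) := by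
        refine mul_le_mul_of_nonneg_left ?_ hC
        refine le_trans (le_of_eq ?_) (dual_value_le hn)
        rw [Finset.range_eq_Ico]
        refine (Finset.sum_Ico_add' (fun i : ℕ => dualDensity ((i : ℝ) / n)) 0 n 1).trans ?_
        exact Finset.sum_congr (by ext; simp) fun _ _ => rfl

/-! ### Reduction to the secretary program by averaging over scales. -/

/-- The secretary bound for a game in which the largest value `k` is drawn with weight `1 / k` and
`A i k` is the probability that the rule takes it at time `i`. -/
theorem sum_acceptance_le {n K : ℕ} (hn : 1 ≤ n) (A : ℕ → ℕ → ℝ) (hA : ∀ i k, 0 ≤ A i k)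
    (h : ∀ i < n, ∀ k ∈ Finset.Icc 1 K, A i k +
      ∑ j ∈ Finset.range i, ∑ m ∈ Finset.Ico 1 k, (m : ℝ) ^ j / (k : ℝ) ^ (j + 1) * A j m ≤ 1) :
    ∑ i ∈ Finset.range n, ∑ k ∈ Finset.Icc 1 K, A i k / k ≤
      (∑ k ∈ Finset.Icc 1 K, 1 / (k : ℝ) + 2 * n) * (n * Real.exp (-1) + 1) := by
  have hA1 : ∀ i < n, ∀ k ∈ Finset.Icc 1 K, A i k ≤ 1 := by
    intro i hi k hk
    refine le_trans ?_ (h i hi k hk)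
    refine le_add_of_nonneg_right ?_
    exact Finset.sum_nonneg fun j _ => Finset.sum_nonneg fun m _ =>
      mul_nonneg (by positivity) (hA _ _)
  refine secretary_lp_bound hn (fun i => ∑ k ∈ Finset.Icc 1 K, A i k / k) _
    (fun i => Finset.sum_nonneg fun k _ => div_nonneg (hA _ _) (by positivity)) ?_
  intro i hi
  -- Since `A j m ≤ 1`, the errors total at most `2` for each `j`; with at most `n` values of `j`
  -- this gives the `2 n` in the bound.
  have lower : ∀ j ∈ Finset.range i, (∑ k ∈ Finset.Icc 1 K, A j k / k) / (j + 1) - 2 ≤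
      ∑ m ∈ Finset.Icc 1 K,
        A j m * ((m : ℝ) ^ j * ∑ k ∈ Finset.Ioc m K, 1 / (k : ℝ) ^ (j + 2)) := by
    intro j hj
    have hj' := Finset.mem_range.1 hj
    have hs := sum_Icc_telescope_le K
    have : ∑ m ∈ Finset.Icc 1 K, (A j m / m / (j + 1) -
        ((1 / (m : ℝ) - 1 / ((m : ℝ) + 1)) + 1 / ((K : ℝ) + 1))) ≤ ∑ m ∈ Finset.Icc 1 K,
        A j m * ((m : ℝ) ^ j * ∑ k ∈ Finset.Ioc m K, 1 / (k : ℝ) ^ (j + 2)) := by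
      refine Finset.sum_le_sum fun m hm => ?_
      have hm' := Finset.mem_Icc.1 hm
      have hm0 : (0 : ℝ) < m := by exact_mod_cast hm'.1
      have h1 := mul_le_mul_of_nonneg_left (pow_mul_sum_Ioc_ge j m K hm'.1 hm'.2) (hA j m)
      have h2 : A j m * ((1 / (m : ℝ) - 1 / ((m : ℝ) + 1)) + 1 / ((K : ℝ) + 1)) ≤
          1 * ((1 / (m : ℝ) - 1 / ((m : ℝ) + 1)) + 1 / ((K : ℝ) + 1)) := by
        refine mul_le_mul_of_nonneg_right (hA1 j (by omega) m hm) ?_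
        have : 1 / ((m : ℝ) + 1) ≤ 1 / m := by gcongr; linarith
        have : 0 ≤ 1 / ((K : ℝ) + 1) := by positivity
        linarith
      have e : A j m / m / (j + 1) = A j m * (1 / ((j + 1) * (m : ℝ))) := by field_simp
      rw [e]
      linarith
    rw [Finset.sum_sub_distrib, ← Finset.sum_div] at this
    linarith
  -- The hypothesis averaged with weights `1 / k`, with the sums exchanged to collect the
  -- coefficient of each `A j m`.
  have upper : ∑ k ∈ Finset.Icc 1 K, A i k / k + ∑ j ∈ Finset.range i, ∑ m ∈ Finset.Icc 1 K,
        A j m * ((m : ℝ) ^ j * ∑ k ∈ Finset.Ioc m K, 1 / (k : ℝ) ^ (j + 2)) ≤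
      ∑ k ∈ Finset.Icc 1 K, 1 / (k : ℝ) := by
    have h1 : ∑ k ∈ Finset.Icc 1 K, (A i k + ∑ j ∈ Finset.range i, ∑ m ∈ Finset.Ico 1 k,
        (m : ℝ) ^ j / (k : ℝ) ^ (j + 1) * A j m) / k ≤ ∑ k ∈ Finset.Icc 1 K, 1 / (k : ℝ) :=
      Finset.sum_le_sum fun k hk => div_le_div_of_nonneg_right (h i hi k hk) (by positivity)
    refine le_trans (le_of_eq ?_) h1
    simp_rw [add_div]
    rw [Finset.sum_add_distrib]
    congr 1
    simp_rw [Finset.sum_div]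
    refine Eq.trans (Finset.sum_congr rfl fun j _ => ?_) Finset.sum_comm
    simp_rw [Finset.mul_sum]
    rw [Finset.sum_comm' (s := Finset.Icc 1 K) (t := fun m => Finset.Ioc m K)
      (t' := Finset.Icc 1 K) (s' := fun k => Finset.Ico 1 k)
      (by intro x y; simp only [Finset.mem_Icc, Finset.mem_Ioc, Finset.mem_Ico]; omega)]
    refine Finset.sum_congr rfl fun k hk => Finset.sum_congr rfl fun m _ => ?_
    have : (0 : ℝ) < k := by exact_mod_cast (Finset.mem_Icc.1 hk).1
    field_simp
    ring
  have hl := Finset.sum_le_sum lower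
  rw [Finset.sum_sub_distrib] at hl
  simp only [Finset.sum_const, Finset.card_range, nsmul_eq_mul] at hl
  have hin : (i : ℝ) ≤ n := by exact_mod_cast hi.le
  linarith

/-! ### Finite product measures. -/

/-- The integral of `f` against the product of the weights `w`. -/
def wsum {ι α : Type*} [Fintype ι] [DecidableEq ι] [Fintype α] (w : ι → α → ℝ)
    (f : (ι → α) → ℝ) : ℝ :=
  ∑ z, (∏ l, w l (z l)) * f z

section wsum

variable {ι α : Type*} [Fintype ι] [DecidableEq ι] [Fintype α]

/-- By Fubini, the coordinates that `f` ignores integrate to `1`. With `p` the times up to `j`, this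
discards the future of a stopping decision. -/
theorem wsum_congr_of_prefix (p : ι → Prop) [DecidablePred p] {w w' : ι → α → ℝ}
    {f : (ι → α) → ℝ} (hw : ∀ l, p l → w l = w' l) (h1 : ∀ l, ¬ p l → ∑ a, w l a = 1)
    (h1' : ∀ l, ¬ p l → ∑ a, w' l a = 1)
    (hf : ∀ z z' : ι → α, (∀ l, p l → z l = z' l) → f z = f z') :
    wsum w f = wsum w' f := by
  classical
  have split : ∀ u : ι → α → ℝ, wsum u f = ∑ a : {l // p l} → α, (∏ l : {l // p l}, u l (a l)) *
      ∑ b : {l // ¬ p l} → α, (∏ l : {l // ¬ p l}, u l (b l)) *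
        f ((Equiv.piEquivPiSubtypeProd p fun _ => α).symm (a, b)) := by
    intro u
    unfold wsum
    rw [← (Equiv.piEquivPiSubtypeProd p fun _ => α).symm.sum_comp, Fintype.sum_prod_type]
    refine Finset.sum_congr rfl fun a _ => ?_
    rw [Finset.mul_sum]
    refine Finset.sum_congr rfl fun b _ => ?_
    rw [← Fintype.prod_subtype_mul_prod_subtype p, ← mul_assoc]
    congr 2
    · refine Finset.prod_congr rfl fun l _ => ?_
      simp [Equiv.piEquivPiSubtypeProd, l.2]
    · refine Finset.prod_congr rfl fun l _ => ?_
      simp [Equiv.piEquivPiSubtypeProd, l.2]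
  rw [split, split]
  refine Finset.sum_congr rfl fun a _ => ?_
  congr 1
  · exact Finset.prod_congr rfl fun l _ => by rw [hw l l.2]
  · by_cases hne : Nonempty ({l // ¬ p l} → α)
    · obtain ⟨b₀⟩ := hne
      have inner : ∀ u : ι → α → ℝ, (∀ l, ¬ p l → ∑ a, u l a = 1) →
          ∑ b : {l // ¬ p l} → α, (∏ l : {l // ¬ p l}, u l (b l)) *
            f ((Equiv.piEquivPiSubtypeProd p fun _ => α).symm (a, b)) =
          f ((Equiv.piEquivPiSubtypeProd p fun _ => α).symm (a, b₀)) := by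
        intro u hu
        have hc : ∀ b, f ((Equiv.piEquivPiSubtypeProd p fun _ => α).symm (a, b)) =
            f ((Equiv.piEquivPiSubtypeProd p fun _ => α).symm (a, b₀)) := by
          intro b
          refine hf _ _ fun l hl => ?_
          simp [Equiv.piEquivPiSubtypeProd, hl]
        simp_rw [hc]
        rw [← Finset.sum_mul, ← Fintype.prod_sum (fun (l : {l // ¬ p l}) a => u l a)]
        rw [Finset.prod_congr rfl fun (l : {l // ¬ p l}) _ => hu l l.2]
        simp
      rw [inner w h1, inner w' h1']
    · rw [not_nonempty_iff] at hne
      simp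

theorem wsum_prod (w φ : ι → α → ℝ) :
    wsum w (fun z => ∏ l, φ l (z l)) = ∏ l, ∑ a, w l a * φ l a := by
  rw [Fintype.prod_sum]
  simp [wsum, Finset.prod_mul_distrib]

theorem wsum_const {w : ι → α → ℝ} (h1 : ∀ l, ∑ a, w l a = 1) (c : ℝ) :
    wsum w (fun _ => c) = c := by
  have := wsum_prod w fun _ _ => 1
  simp only [mul_one, h1, Finset.prod_const_one] at this
  unfold wsum at this ⊢
  rw [← Finset.sum_mul]
  simp only [mul_one] at this
  rw [this, one_mul]

theorem wsum_eval [DecidableEq α] {w : ι → α → ℝ} (h1 : ∀ l, ∑ a, w l a = 1) (i : ι) (b : α) :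
    wsum w (fun z => if z i = b then 1 else 0) = w i b := by
  have h := wsum_prod w fun l a => if l = i then (if a = b then 1 else 0) else 1
  have e : (fun z : ι → α => ∏ l, if l = i then (if z l = b then (1 : ℝ) else 0) else 1) =
      fun z => if z i = b then 1 else 0 := by
    funext z
    rw [Finset.prod_ite_eq' Finset.univ i (fun l => if z l = b then (1 : ℝ) else 0)]
    simp
  rw [e] at h
  rw [h]
  have : ∀ l, ∑ a, w l a * (if l = i then (if a = b then 1 else 0) else 1) =
      if l = i then w l b else 1 := by
    intro l
    split_ifs <;> simp [h1]
  rw [Finset.prod_congr rfl fun l _ => this l]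
  simp

theorem wsum_le_wsum {w : ι → α → ℝ} (hw : ∀ l a, 0 ≤ w l a) {f g : (ι → α) → ℝ}
    (h : ∀ z, (∀ l, w l (z l) ≠ 0) → f z ≤ g z) : wsum w f ≤ wsum w g := by
  refine Finset.sum_le_sum fun z _ => ?_
  by_cases hz : ∀ l, w l (z l) ≠ 0
  · exact mul_le_mul_of_nonneg_left (h z hz) (Finset.prod_nonneg fun l _ => hw _ _)
  · push Not at hz
    obtain ⟨l, hl⟩ := hz
    rw [Finset.prod_eq_zero (Finset.mem_univ l) hl]
    simp

theorem wsum_nonneg {w : ι → α → ℝ} (hw : ∀ l a, 0 ≤ w l a) {f : (ι → α) → ℝ}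
    (h : ∀ z, 0 ≤ f z) : 0 ≤ wsum w f :=
  Finset.sum_nonneg fun _ _ => mul_nonneg (Finset.prod_nonneg fun _ _ => hw _ _) (h _)

theorem wsum_add (w : ι → α → ℝ) (f g : (ι → α) → ℝ) :
    wsum w (fun z => f z + g z) = wsum w f + wsum w g := by
  simp [wsum, mul_add, Finset.sum_add_distrib]

theorem wsum_sub (w : ι → α → ℝ) (f g : (ι → α) → ℝ) :
    wsum w (fun z => f z - g z) = wsum w f - wsum w g := by
  simp [wsum, mul_sub, Finset.sum_sub_distrib]

theorem wsum_mul_left (w : ι → α → ℝ) (c : ℝ) (f : (ι → α) → ℝ) :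
    wsum w (fun z => c * f z) = c * wsum w f := by
  unfold wsum
  rw [Finset.mul_sum]
  exact Finset.sum_congr rfl fun _ _ => by ring

theorem wsum_sum {κ : Type*} (w : ι → α → ℝ) (s : Finset κ) (f : κ → (ι → α) → ℝ) :
    wsum w (fun z => ∑ i ∈ s, f i z) = ∑ i ∈ s, wsum w (f i) := by
  unfold wsum
  rw [Finset.sum_comm]
  exact Finset.sum_congr rfl fun _ _ => Finset.mul_sum _ _ _

end wsum

/-! ### Records and acceptance probabilities. -/

/-- The uniform weight on `{0, …, m - 1}`. -/
noncomputable def uniformBelow (N m : ℕ) (a : Fin N) : ℝ := if (a : ℕ) < m then 1 / (m : ℝ) else 0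

/-- The point weight at `m`. -/
def pointWeight (N m : ℕ) (a : Fin N) : ℝ := if (a : ℕ) = m then 1 else 0

theorem sum_fin_below {N m : ℕ} (hm : m ≤ N) (c : ℝ) :
    ∑ a : Fin N, (if (a : ℕ) < m then c else 0) = m * c := by
  rw [Fin.sum_univ_eq_sum_range (fun a => if a < m then c else 0), ← Finset.sum_filter]
  have : (Finset.range N).filter (· < m) = Finset.range m := by ext; simp; omega
  rw [this]
  simp

theorem sum_fin_point {N m : ℕ} (hm : m < N) (c : ℝ) :
    ∑ a : Fin N, (if (a : ℕ) = m then c else 0) = c := by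
  rw [Fin.sum_univ_eq_sum_range (fun a => if a = m then c else 0)]
  simp [hm]

theorem sum_uniformBelow {N m : ℕ} (hm : 1 ≤ m) (hmN : m < N) :
    ∑ a, uniformBelow N m a = 1 := by
  have : (m : ℝ) ≠ 0 := by positivity
  unfold uniformBelow
  rw [sum_fin_below hmN.le]
  field_simp

theorem sum_pointWeight {N m : ℕ} (hmN : m < N) : ∑ a, pointWeight N m a = 1 :=
  sum_fin_point hmN 1

/-- Coordinates before time `j` are uniform below `m`, the others are equal to `m`. -/
noncomputable def recordWeight (n N j m : ℕ) (l : Fin n) : Fin N → ℝ :=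
  if (l : ℕ) < j then uniformBelow N m else pointWeight N m

theorem recordWeight_nonneg (n N j m : ℕ) (l : Fin n) (a : Fin N) :
    0 ≤ recordWeight n N j m l a := by
  unfold recordWeight uniformBelow pointWeight
  split_ifs <;> positivity

theorem sum_recordWeight {n N j m : ℕ} (hm : 1 ≤ m) (hmN : m < N) (l : Fin n) :
    ∑ a, recordWeight n N j m l a = 1 := by
  unfold recordWeight
  split_ifs
  · exact sum_uniformBelow hm hmN
  · exact sum_pointWeight hmN

/-- The mean of `f` when the value at time `j` is `m` and the earlier ones are uniform below. -/
noncomputable def acceptance {n N : ℕ} (f : (Fin n → Fin N) → ℝ) (j m : ℕ) : ℝ :=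
  wsum (recordWeight n N j m) f

/-- The value at time `j` is `m` and exceeds all earlier values. -/
def IsRecord {n N : ℕ} (z : Fin n → Fin N) (j : Fin n) (m : ℕ) : Prop :=
  (z j : ℕ) = m ∧ ∀ l < j, (z l : ℕ) < m

open scoped Classical in
/-- The indicator of `IsRecord`. -/
noncomputable def recordInd {n N : ℕ} (z : Fin n → Fin N) (j : Fin n) (m : ℕ) : ℝ :=
  if IsRecord z j m then 1 else 0

theorem sum_recordInd_values_le {n N : ℕ} (z : Fin n → Fin N) (j : Fin n) (s : Finset ℕ) :
    ∑ m ∈ s, recordInd z j m ≤ 1 := by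
  classical
  calc ∑ m ∈ s, recordInd z j m ≤ ∑ m ∈ s, if (z j : ℕ) = m then (1 : ℝ) else 0 := by
        refine Finset.sum_le_sum fun m _ => ?_
        unfold recordInd IsRecord
        split_ifs with h1 h2 <;> first | exact absurd h1.1 h2 | norm_num
    _ ≤ 1 := by
        rw [Finset.sum_ite_eq]
        split_ifs <;> norm_num

/-- Records are strict, so a given value is a record at most once. -/
theorem sum_recordInd_times_le {n N : ℕ} (z : Fin n → Fin N) (m : ℕ) :
    ∑ j, recordInd z j m ≤ if ∃ l, (z l : ℕ) = m then 1 else 0 := by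
  classical
  by_cases h : ∃ j, IsRecord z j m
  · obtain ⟨j, hj⟩ := h
    rw [if_pos ⟨j, hj.1⟩, Finset.sum_eq_single j]
    · simp [recordInd, hj]
    · intro i _ hij
      refine if_neg fun hi => ?_
      rcases lt_or_gt_of_ne hij with h | h
      · exact absurd hi.1 (hj.2 i h).ne
      · exact absurd hj.1 (hi.2 j h).ne
    · simp
  · push Not at h
    rw [Finset.sum_eq_zero fun j _ => show recordInd z j m = 0 from if_neg (h j)]
    split_ifs <;> norm_num

/-- Weights constant below `m` become uniform there once conditioned on the record, so the
conditional mean of `f` does not depend on `w`. The prefactor is the probability of the record. It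
is used both for the spike law and for the law preceding a larger record. -/
theorem wsum_record {n N : ℕ} {w : Fin n → Fin N → ℝ} {f : (Fin n → Fin N) → ℝ} (j : Fin n)
    (m : ℕ) (hm : 1 ≤ m) (hmN : m < N) (β : ℝ) (h1 : ∀ l, ∑ a, w l a = 1)
    (hβ : ∀ l < j, ∀ a : Fin N, (a : ℕ) < m → w l a = β)
    (hf : ∀ z z' : Fin n → Fin N, (∀ l ≤ j, z l = z' l) → f z = f z') :
    wsum w (fun z => recordInd z j m * f z) =
      w j ⟨m, hmN⟩ * (β * m) ^ (j : ℕ) * acceptance f j m := by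
  classical
  have hm0 : (m : ℝ) ≠ 0 := by positivity
  -- `c` is the conditional law of each coordinate given the record, and `s` the probability of the
  -- condition on that coordinate; the claim is then compared pointwise in `z`.
  set c : Fin n → Fin N → ℝ := fun l =>
    if l < j then uniformBelow N m else if l = j then pointWeight N m else w l with hc
  set s : Fin n → ℝ := fun l => if l < j then β * m else if l = j then w j ⟨m, hmN⟩ else 1 with hs
  have e1 : acceptance f j m = wsum c f := by
    refine wsum_congr_of_prefix (fun l => l ≤ j) ?_ (fun l _ => sum_recordWeight hm hmN l) ?_ hf
    · intro l hl
      rcases hl.lt_or_eq with h | h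
      · have h' : (l : ℕ) < j := h
        simp [hc, recordWeight, h, h']
      · simp [hc, recordWeight, h]
    · intro l hl
      have h2 : ¬ l < j := fun h => hl h.le
      have h3 : l ≠ j := fun h => hl h.le
      simp [hc, h2, h3, h1]
  have e2 : ∏ l, s l = w j ⟨m, hmN⟩ * (β * m) ^ (j : ℕ) := by
    have hsplit : ∀ l, s l = (if l < j then β * m else 1) *
        (if l = j then w j ⟨m, hmN⟩ else 1) := by
      intro l
      by_cases hl : l < j
      · simp [hs, hl, hl.ne]
      · simp [hs, hl]
    simp_rw [hsplit]
    rw [Finset.prod_mul_distrib, Finset.prod_ite_eq' Finset.univ j, mul_comm,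
      ← Finset.prod_filter]
    have hcard : (Finset.univ.filter (· < j)).card = (j : ℕ) := by
      rw [← Fin.card_Iio]
      congr 1
      ext
      simp
    simp [hcard]
  rw [e1, ← e2, ← wsum_mul_left]
  unfold wsum
  refine Finset.sum_congr rfl fun z _ => ?_
  rw [← mul_assoc, ← mul_assoc, ← Finset.prod_mul_distrib]
  congr 1
  by_cases hr : IsRecord z j m
  · rw [recordInd, if_pos hr, mul_one]
    refine Finset.prod_congr rfl fun l _ => ?_
    rcases lt_trichotomy l j with h | h | h
    · have h2 := hr.2 l h
      simp only [hc, hs, h, if_true, uniformBelow, h2]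
      rw [hβ l h _ h2]
      field_simp
    · subst h
      have : z l = ⟨m, hmN⟩ := Fin.ext hr.1
      simp [hc, hs, pointWeight, this]
    · simp [hc, hs, h.not_gt, h.ne']
  · rw [recordInd, if_neg hr, mul_zero]
    symm
    unfold IsRecord at hr
    by_cases hj : (z j : ℕ) = m
    · have : ∃ l < j, ¬ (z l : ℕ) < m := by
        by_contra hcon
        push Not at hcon
        exact hr ⟨hj, hcon⟩
      obtain ⟨l, hl, hlm⟩ := this
      refine Finset.prod_eq_zero (Finset.mem_univ l) ?_
      simp [hc, hl, uniformBelow, hlm]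
    · refine Finset.prod_eq_zero (Finset.mem_univ j) ?_
      simp [hc, pointWeight, hj]

theorem acceptance_nonneg {n N : ℕ} {f : (Fin n → Fin N) → ℝ} (hf : ∀ z, 0 ≤ f z) (j m : ℕ) :
    0 ≤ acceptance f j m :=
  wsum_nonneg (recordWeight_nonneg n N j m) hf

/-- The rule that stops at time `j` with probability `q j z` cannot take the record `k` at time `i`
if it has taken an earlier, smaller record. -/
theorem acceptance_add_sum_le {n N : ℕ} {q : Fin n → (Fin n → Fin N) → ℝ}
    (hq : ∀ j z, 0 ≤ q j z) (hsum : ∀ z, ∑ j, q j z ≤ 1)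
    (hdep : ∀ j, ∀ z z' : Fin n → Fin N, (∀ l ≤ j, z l = z' l) → q j z = q j z')
    (i : Fin n) (k : ℕ) (hk : 1 ≤ k) (hkN : k < N) :
    acceptance (q i) i k + ∑ j ∈ Finset.Iio i, ∑ m ∈ Finset.Ico 1 k,
      (m : ℝ) ^ (j : ℕ) / (k : ℝ) ^ ((j : ℕ) + 1) * acceptance (q j) j m ≤ 1 := by
  have hk0 : (k : ℝ) ≠ 0 := by positivity
  -- Times before `i` are uniform below `k`, so a record `m` occurs at `j` with probability `(1 / k)
  -- (m / k) ^ j`.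
  have hterm : ∀ j ∈ Finset.Iio i, ∀ m ∈ Finset.Ico 1 k,
      (m : ℝ) ^ (j : ℕ) / (k : ℝ) ^ ((j : ℕ) + 1) * acceptance (q j) j m =
      wsum (recordWeight n N i k) (fun z => recordInd z j m * q j z) := by
    intro j hj m hm
    have hji : (j : ℕ) < i := Fin.lt_def.1 (Finset.mem_Iio.1 hj)
    have hm' := Finset.mem_Ico.1 hm
    rw [wsum_record j m hm'.1 (hm'.2.trans hkN) (1 / (k : ℝ)) (sum_recordWeight hk hkN) ?_
      (hdep j)]
    · simp only [recordWeight, hji, if_true, uniformBelow, hm'.2]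
      rw [mul_pow, div_pow, one_pow, pow_succ]
      field_simp
    · intro l hl a ha
      have hli : (l : ℕ) < i := lt_trans (show (l : ℕ) < j from hl) hji
      have hak : (a : ℕ) < k := ha.trans hm'.2
      simp [recordWeight, hli, uniformBelow, hak]
  rw [Finset.sum_congr rfl fun j hj => Finset.sum_congr rfl (hterm j hj)]
  simp_rw [← wsum_sum]
  rw [acceptance, ← wsum_add]
  refine le_trans (wsum_le_wsum (g := fun _ => 1) (recordWeight_nonneg n N i k) ?_)
    (wsum_const (sum_recordWeight hk hkN) 1).le
  intro z _
  have h1 : ∀ j ∈ Finset.Iio i, ∑ m ∈ Finset.Ico 1 k, recordInd z j m * q j z ≤ q j z := by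
    intro j _
    rw [← Finset.sum_mul]
    exact mul_le_of_le_one_left (hq j z) (sum_recordInd_values_le z j _)
  calc q i z + ∑ j ∈ Finset.Iio i, ∑ m ∈ Finset.Ico 1 k, recordInd z j m * q j z
      ≤ q i z + ∑ j ∈ Finset.Iio i, q j z := by gcongr with j hj; exact h1 j hj
    _ = ∑ j ∈ insert i (Finset.Iio i), q j z := by rw [Finset.sum_insert (by simp)]
    _ ≤ ∑ j, q j z :=
        Finset.sum_le_sum_of_subset_of_nonneg (Finset.subset_univ _) fun j _ _ => hq j z
    _ ≤ 1 := hsum z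

theorem sum_acceptance_fin_le {n K : ℕ} (hn : 1 ≤ n)
    {q : Fin n → (Fin n → Fin (K + 1)) → ℝ}
    (hq : ∀ j z, 0 ≤ q j z) (hsum : ∀ z, ∑ j, q j z ≤ 1)
    (hdep : ∀ j, ∀ z z' : Fin n → Fin (K + 1), (∀ l ≤ j, z l = z' l) → q j z = q j z') :
    ∑ k ∈ Finset.Icc 1 K, (∑ i, acceptance (q i) i k) / k ≤
      (∑ k ∈ Finset.Icc 1 K, 1 / (k : ℝ) + 2 * n) * (n * Real.exp (-1) + 1) := by
  set A : ℕ → ℕ → ℝ := fun i k => if h : i < n then acceptance (q ⟨i, h⟩) i k else 0 with hA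
  have hAfin : ∀ (i : Fin n) k, A i k = acceptance (q i) i k := fun i k => by simp [hA]
  have h := sum_acceptance_le (K := K) hn A
    (by
      intro i k
      simp only [hA]
      split_ifs
      · exact acceptance_nonneg (hq _) _ _
      · rfl)
    (by
      intro i hi k hk
      have hk' := Finset.mem_Icc.1 hk
      refine le_of_eq_of_le ?_
        (acceptance_add_sum_le hq hsum hdep ⟨i, hi⟩ k hk'.1 (by omega))
      have hmap : Finset.range i =
          (Finset.Iio (⟨i, hi⟩ : Fin n)).map Fin.valEmbedding := by
        rw [Fin.map_valEmbedding_Iio, Nat.Iio_eq_range]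
      rw [← hAfin ⟨i, hi⟩, hmap, Finset.sum_map]
      congr 1
      exact Finset.sum_congr rfl fun j _ => Finset.sum_congr rfl fun m _ => by
        rw [← hAfin j]; rfl)
  rw [Finset.sum_comm] at h
  refine le_of_eq_of_le (Finset.sum_congr rfl fun k _ => ?_) h
  rw [Finset.sum_div, Finset.sum_range]
  exact Finset.sum_congr rfl fun i _ => by rw [hAfin]

/-! ### Prophet and gambler at a fixed scale. -/

/-- The weights of the distribution with mass `ε` at `k`, the rest uniform below `k`. -/
noncomputable def spikeWeight (N k : ℕ) (ε : ℝ) (a : Fin N) : ℝ :=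
  if (a : ℕ) < k then (1 - ε) / k else if (a : ℕ) = k then ε else 0

theorem spikeWeight_nonneg {N k : ℕ} {ε : ℝ} (h0 : 0 ≤ ε) (h1 : ε ≤ 1) (a : Fin N) :
    0 ≤ spikeWeight N k ε a := by
  unfold spikeWeight
  split_ifs
  · exact div_nonneg (by linarith) (by positivity)
  · exact h0
  · rfl

theorem sum_spikeWeight {N k : ℕ} (hk : 1 ≤ k) (hkN : k < N) (ε : ℝ) :
    ∑ a, spikeWeight N k ε a = 1 := by
  have hk0 : (k : ℝ) ≠ 0 := by positivity
  have e : ∀ a : Fin N, spikeWeight N k ε a =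
      (if (a : ℕ) < k then (1 - ε) / k else 0) + (if (a : ℕ) = k then ε else 0) := by
    intro a
    unfold spikeWeight
    split_ifs <;> first | omega | simp
  simp_rw [e]
  rw [Finset.sum_add_distrib, sum_fin_below hkN.le, sum_fin_point hkN]
  field_simp
  ring

section spike

variable {n N k : ℕ} {ε : ℝ}

theorem wsum_spike_record {f : (Fin n → Fin N) → ℝ} (hk : 1 ≤ k) (hkN : k < N) (j : Fin n)
    (hf : ∀ z z' : Fin n → Fin N, (∀ l ≤ j, z l = z' l) → f z = f z') :
    wsum (fun _ => spikeWeight N k ε) (fun z => recordInd z j k * f z) =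
      ε * (1 - ε) ^ (j : ℕ) * acceptance f j k := by
  have hk0 : (k : ℝ) ≠ 0 := by positivity
  rw [wsum_record j k hk hkN ((1 - ε) / k) (fun _ => sum_spikeWeight hk hkN ε) ?_ hf]
  · rw [div_mul_cancel₀ _ hk0]
    simp [spikeWeight]
  · intro l _ a ha
    simp [spikeWeight, ha]

theorem wsum_spike_recordInd (hk : 1 ≤ k) (hkN : k < N) (j : Fin n) :
    wsum (fun _ => spikeWeight N k ε) (fun z => recordInd z j k) = ε * (1 - ε) ^ (j : ℕ) := by
  have h := wsum_spike_record (ε := ε) (f := fun _ => 1) hk hkN j (fun _ _ _ => rfl)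
  rw [acceptance, wsum_const (sum_recordWeight hk hkN)] at h
  simpa using h

theorem one_sub_mul_le_pow (h0 : 0 ≤ ε) (h1 : ε ≤ 1) (j : Fin n) :
    1 - n * ε ≤ (1 - ε) ^ (j : ℕ) := by
  have hb := one_add_mul_le_pow (a := -ε) (by linarith) (j : ℕ)
  rw [← sub_eq_add_neg] at hb
  have hj : ((j : ℕ) : ℝ) ≤ n := by exact_mod_cast j.2.le
  have := mul_le_mul_of_nonneg_right hj h0
  linarith

/-- The first spike occurs at time `j` with probability `ε (1 - ε) ^ j ≥ ε (1 - n ε)`, and these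
events are disjoint. -/
theorem wsum_spike_max_ge (h0 : 0 ≤ ε) (h1 : ε ≤ 1) (hk : 1 ≤ k) (hkN : k < N) {V : ℝ}
    (hV : 0 ≤ V) {g : (Fin n → Fin N) → ℝ} (hg0 : ∀ z, 0 ≤ g z)
    (hg : ∀ z, (∃ l, (z l : ℕ) = k) → V ≤ g z) :
    V * (n * ε * (1 - n * ε)) ≤ wsum (fun _ => spikeWeight N k ε) g := by
  have hle : wsum (fun _ : Fin n => spikeWeight N k ε) (fun z => V * ∑ j, recordInd z j k) ≤
      wsum (fun _ => spikeWeight N k ε) g := by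
    refine wsum_le_wsum (fun _ => spikeWeight_nonneg h0 h1) fun z _ => ?_
    have hr := mul_le_mul_of_nonneg_left (sum_recordInd_times_le z k) hV
    refine hr.trans ?_
    split_ifs with h
    · simpa using hg z h
    · simpa using hg0 z
  refine le_trans ?_ hle
  rw [wsum_mul_left, wsum_sum]
  refine mul_le_mul_of_nonneg_left ?_ hV
  calc (n : ℝ) * ε * (1 - n * ε) = ∑ _j : Fin n, ε * (1 - n * ε) := by simp; ring
    _ ≤ _ := by
      refine Finset.sum_le_sum fun j _ => ?_
      rw [wsum_spike_recordInd hk hkN]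
      exact mul_le_mul_of_nonneg_left (one_sub_mul_le_pow h0 h1 j) h0

/-- The three terms account for stopping below the spike, stopping at the first spike, and the
expected number of repeated spikes, which is at most `(n ε) ^ 2`. -/
theorem wsum_spike_reward_le (h0 : 0 ≤ ε) (h1 : ε ≤ 1) (hk : 1 ≤ k) (hkN : k < N)
    {q : Fin n → (Fin n → Fin N) → ℝ} (hq : ∀ j z, 0 ≤ q j z) (hsum : ∀ z, ∑ j, q j z ≤ 1)
    (hdep : ∀ j, ∀ z z' : Fin n → Fin N, (∀ l ≤ j, z l = z' l) → q j z = q j z')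
    {v : Fin N → ℝ} {V c : ℝ} (hc : 0 ≤ c) (hV : 0 ≤ V)
    (hvk : ∀ a : Fin N, (a : ℕ) = k → v a = V) (hv : ∀ a : Fin N, (a : ℕ) < k → v a ≤ c * V) :
    wsum (fun _ => spikeWeight N k ε) (fun z => ∑ i, q i z * v (z i)) ≤
      V * (c + ε * ∑ i, acceptance (q i) i k + (n * ε) ^ 2) := by
  classical
  set b : Fin N := ⟨k, hkN⟩ with hb
  have hq1 : ∀ i z, q i z ≤ 1 := fun i z =>
    (Finset.single_le_sum (f := fun j => q j z) (fun j _ => hq j z) (Finset.mem_univ i)).trans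
      (hsum z)
  have hle : wsum (fun _ : Fin n => spikeWeight N k ε) (fun z => ∑ i, q i z * v (z i)) ≤
      wsum (fun _ => spikeWeight N k ε) (fun z => V * (c + (∑ i, recordInd z i k * q i z +
        ∑ i, ((if z i = b then 1 else 0) - recordInd z i k)))) := by
    refine wsum_le_wsum (fun _ => spikeWeight_nonneg h0 h1) fun z hz => ?_
    have hterm : ∀ i, q i z * v (z i) ≤ V * (c * q i z + (recordInd z i k * q i z +
        ((if z i = b then 1 else 0) - recordInd z i k))) := by
      intro i
      have hcase : (z i : ℕ) < k ∨ (z i : ℕ) = k := by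
        by_contra hcon
        push Not at hcon
        refine hz i ?_
        unfold spikeWeight
        rw [if_neg (by omega), if_neg (by omega)]
      rcases hcase with h | h
      · have h2 : z i ≠ b := fun h' => by rw [h'] at h; simp [hb] at h
        have h3 : recordInd z i k = 0 := if_neg fun hr => h.ne hr.1
        rw [if_neg h2, h3]
        have := mul_le_mul_of_nonneg_left (hv _ h) (hq i z)
        linarith
      · have h2 : z i = b := Fin.ext h
        rw [if_pos h2, hvk _ h]
        have hr : recordInd z i k ≤ 1 := by unfold recordInd; split_ifs <;> norm_num
        have h4 : q i z ≤ c * q i z + (recordInd z i k * q i z + (1 - recordInd z i k)) := by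
          have := mul_nonneg (sub_nonneg.2 hr) (sub_nonneg.2 (hq1 i z))
          have := mul_nonneg hc (hq i z)
          linarith
        rw [mul_comm]
        exact mul_le_mul_of_nonneg_left h4 hV
    refine (Finset.sum_le_sum fun i _ => hterm i).trans ?_
    rw [← Finset.mul_sum, Finset.sum_add_distrib, Finset.sum_add_distrib, ← Finset.mul_sum]
    have := mul_le_mul_of_nonneg_left (hsum z) hc
    gcongr
    linarith
  refine hle.trans ?_
  rw [wsum_mul_left, wsum_add, wsum_const (fun _ => sum_spikeWeight hk hkN ε), wsum_add, wsum_sum,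
    wsum_sum, add_assoc]
  gcongr V * (c + (?_ + ?_))
  · rw [Finset.mul_sum]
    refine Finset.sum_le_sum fun i _ => ?_
    rw [wsum_spike_record hk hkN i (hdep i)]
    have hp : (1 - ε) ^ (i : ℕ) ≤ 1 := pow_le_one₀ (by linarith) (by linarith)
    have := mul_le_mul_of_nonneg_left hp h0
    have := mul_le_mul_of_nonneg_right this (acceptance_nonneg (hq i) i k)
    linarith
  · calc _ ≤ ∑ _i : Fin n, ε * (n * ε) := by
          refine Finset.sum_le_sum fun i _ => ?_
          rw [wsum_sub, wsum_eval (fun _ => sum_spikeWeight hk hkN ε), wsum_spike_recordInd hk hkN]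
          have hp := one_sub_mul_le_pow h0 h1 i
          have := mul_le_mul_of_nonneg_left hp h0
          simp only [spikeWeight, hb, lt_irrefl, if_false, if_true]
          linarith
      _ = (n * ε) ^ 2 := by simp; ring

end spike

/-! ### From `PMF` expectations to finite weighted sums. -/

theorem expect_bind {Ω Ω' : Type} (P : PMF Ω) (f : Ω → PMF Ω') (g : Ω' → ℝ≥0) :
    expect (P.bind f) g = ∑' a, P a * expect (f a) g := by
  unfold expect
  simp_rw [PMF.bind_apply, ← ENNReal.tsum_mul_right, ← ENNReal.tsum_mul_left]
  rw [ENNReal.tsum_comm]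
  simp_rw [mul_assoc]

theorem expect_pure {Ω : Type} (a : Ω) (g : Ω → ℝ≥0) : expect (PMF.pure a) g = g a := by
  classical
  unfold expect
  rw [tsum_eq_single a]
  · simp
  · intro b hb
    simp [hb]

theorem expect_map {Ω Ω' : Type} (P : PMF Ω) (f : Ω → Ω') (g : Ω' → ℝ≥0) :
    expect (P.map f) g = expect P (fun a => g (f a)) := by
  rw [← PMF.bind_pure_comp, expect_bind]
  simp only [Function.comp_apply, expect_pure]
  rfl

theorem map_apply_of_injective {Ω Ω' : Type} (P : PMF Ω) {f : Ω → Ω'} (hf : Function.Injective f)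
    (a : Ω) : P.map f (f a) = P a := by
  classical
  rw [PMF.map_apply, tsum_eq_single a]
  · simp
  · intro b hb
    exact if_neg fun h => hb (hf h.symm)

/-- Sequences leaving the range of `v` have weight zero, and injectivity matches the others one to
one with index sequences. -/
theorem expect_iid_map {α : Type} [Fintype α] [DecidableEq α] {v : α → ℝ≥0}
    (hv : Function.Injective v) (G : PMF α) {w : α → ℝ} (hw : ∀ a, 0 ≤ w a)
    (hG : ∀ a, G a = ENNReal.ofReal (w a)) (n : ℕ) (g : (Fin n → ℝ≥0) → ℝ≥0) :
    expect (iid (G.map v) n) g =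
      ENNReal.ofReal (wsum (fun _ : Fin n => w) (fun z => (g (fun l => v (z l)) : ℝ))) := by
  unfold expect wsum
  rw [ENNReal.ofReal_sum_of_nonneg fun z _ =>
    mul_nonneg (Finset.prod_nonneg fun l _ => hw _) (NNReal.coe_nonneg _)]
  have hinj : Function.Injective fun (z : Fin n → α) (l : Fin n) => v (z l) :=
    fun z z' h => funext fun l => hv (congrFun h l)
  rw [← hinj.tsum_eq, tsum_fintype]
  · refine Finset.sum_congr rfl fun z _ => ?_
    rw [ENNReal.ofReal_mul (Finset.prod_nonneg fun l _ => hw _),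
      ENNReal.ofReal_prod_of_nonneg fun l _ => hw _, iid_apply, ENNReal.ofReal_coe_nnreal]
    simp_rw [map_apply_of_injective G hv, hG]
  · intro x hx
    by_contra hcon
    have : ∃ l, x l ∉ Set.range v := by
      by_contra h
      push Not at h
      choose z hz using h
      exact hcon ⟨z, funext hz⟩
    obtain ⟨l, hl⟩ := this
    refine hx ?_
    have h0 : G.map v (x l) = 0 := by
      rw [PMF.apply_eq_zero_iff, PMF.support_map]
      rintro ⟨a, _, ha⟩
      exact hl ⟨a, ha⟩
    simp only [iid_apply]
    rw [Finset.prod_eq_zero (Finset.mem_univ l) h0, zero_mul]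

/-- The prior that draws `k` from `κ` and then the law of `v` under `G k`. -/
noncomputable def mixturePrior {ι α : Type} [Finite ι] [Finite α] (κ : PMF ι) (G : ι → PMF α)
    (v : α → ℝ≥0) : Prior :=
  ⟨κ.map fun k => (G k).map v, by
    rw [PMF.support_map]
    refine ⟨Set.toFinite _, ?_⟩
    rintro F ⟨k, _, rfl⟩
    rw [PMF.support_map]
    exact Set.toFinite _⟩

theorem expect_valueLaw_mixturePrior {ι α : Type} [Fintype ι] [Fintype α] [DecidableEq α]
    {v : α → ℝ≥0} (hv : Function.Injective v) (κ : PMF ι) (G : ι → PMF α) {p : ι → ℝ}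
    {w : ι → α → ℝ} (hp : ∀ k, 0 ≤ p k) (hw : ∀ k a, 0 ≤ w k a)
    (hκ : ∀ k, κ k = ENNReal.ofReal (p k)) (hG : ∀ k a, G k a = ENNReal.ofReal (w k a))
    (n : ℕ) (g : (Fin n → ℝ≥0) → ℝ≥0) :
    expect ((mixturePrior κ G v).valueLaw n) g = ENNReal.ofReal (∑ k, p k *
      wsum (fun _ : Fin n => w k) (fun z => (g (fun l => v (z l)) : ℝ))) := by
  have h0 : ∀ k, 0 ≤ wsum (fun _ : Fin n => w k) (fun z => (g (fun l => v (z l)) : ℝ)) :=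
    fun k => wsum_nonneg (fun _ => hw k) fun _ => NNReal.coe_nonneg _
  rw [ENNReal.ofReal_sum_of_nonneg fun k _ => mul_nonneg (hp k) (h0 k)]
  simp only [Prior.valueLaw, mixturePrior]
  rw [PMF.bind_map, expect_bind, tsum_fintype]
  refine Finset.sum_congr rfl fun k _ => ?_
  rw [ENNReal.ofReal_mul (hp k), hκ, Function.comp_apply,
    expect_iid_map hv (G k) (hw k) (hG k)]

/-- The mean reward of the rule on the value sequence `x`. -/
noncomputable def rewardGiven {n : ℕ} (r : StoppingRule n) (θ : Prior) (x : Fin n → ℝ≥0) : ℝ≥0 :=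
  ∑ i : Fin n, (r.timeWeight θ x i).toNNReal * x i

theorem expectedReward_eq_expect_rewardGiven (θ : Prior) {n : ℕ} (r : StoppingRule n) :
    expectedReward θ r = expect (θ.valueLaw n) (rewardGiven r θ) := by
  unfold expectedReward Prior.jointLaw
  rw [expect_bind]
  unfold expect
  refine tsum_congr fun x => ?_
  congr 1
  have h := expect_map (r.timeLaw θ x) (fun t => (x, t)) fun ω => reward ω.1 ω.2
  unfold expect at h
  rw [h, tsum_fintype]
  refine (Fintype.sum_option _).trans ?_
  have htop : ((reward x (none : WithTop (Fin n)) : ℝ≥0) : ℝ≥0∞) = 0 := by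
    change ((reward x ⊤ : ℝ≥0) : ℝ≥0∞) = 0
    simp [reward]
  rw [htop, mul_zero, zero_add, rewardGiven]
  push_cast
  rfl

theorem coe_rewardGiven {n : ℕ} (r : StoppingRule n) (θ : Prior) (x : Fin n → ℝ≥0) :
    (rewardGiven r θ x : ℝ) = ∑ i : Fin n, r.timeWeight θ x i * x i := by
  unfold rewardGiven
  push_cast
  exact Finset.sum_congr rfl fun i _ => by
    rw [Real.coe_toNNReal _ (r.timeWeight_nonneg θ x i)]

/-- The rule is non-anticipating; this supplies the prefix hypothesis of the record lemmas. -/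
theorem timeWeight_congr {n : ℕ} (r : StoppingRule n) (θ : Prior) (i : Fin n)
    {x x' : Fin n → ℝ≥0} (h : ∀ l ≤ i, x l = x' l) :
    r.timeWeight θ x i = r.timeWeight θ x' i := by
  have hs : ∀ j ≤ i, r.stopProb θ x j = r.stopProb θ x' j := by
    intro j hj
    have : observed x j = observed x' j := by
      funext l
      refine h _ (le_trans ?_ hj)
      exact Fin.le_def.2 (Nat.lt_succ_iff.1 l.2)
    simp only [StoppingRule.stopProb, this]
  simp only [StoppingRule.timeWeight]
  rw [hs i le_rfl]
  congr 1
  refine Finset.prod_congr rfl fun j hj => ?_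
  rw [hs j (Finset.mem_filter.1 hj).2.le]

theorem sum_timeWeight_coe_le {n : ℕ} (r : StoppingRule n) (θ : Prior) (x : Fin n → ℝ≥0) :
    ∑ i : Fin n, r.timeWeight θ x i ≤ 1 := by
  have h := r.sum_timeWeight θ x
  have h2 : ∑ t, r.timeWeight θ x t = r.timeWeight θ x ⊤ + ∑ i : Fin n, r.timeWeight θ x i :=
    Fintype.sum_option (r.timeWeight θ x)
  have := r.timeWeight_nonneg θ x ⊤
  linarith

/-! ### The hard prior and the choice of parameters. -/

theorem sum_fin_succ_eq_sum_Icc (K : ℕ) (f : ℕ → ℝ) :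
    ∑ k : Fin K, f (k + 1) = ∑ k ∈ Finset.Icc 1 K, f k := by
  rw [Fin.sum_univ_eq_sum_range (fun k => f (k + 1)), Finset.range_eq_Ico]
  refine (Finset.sum_Ico_add' f 0 K 1).trans ?_
  exact Finset.sum_congr (by ext; simp) fun _ _ => rfl

/-- The distribution with mass `ε` at `k + 1`, the rest uniform on `{0, …, k}`. -/
noncomputable def spikePMF {K : ℕ} (ε : ℝ) (h0 : 0 ≤ ε) (h1 : ε ≤ 1) (k : Fin K) :
    PMF (Fin (K + 1)) :=
  PMF.ofFintype (fun a => ENNReal.ofReal (spikeWeight (K + 1) (k + 1) ε a)) (by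
    rw [← ENNReal.ofReal_sum_of_nonneg fun a _ => spikeWeight_nonneg h0 h1 a,
      sum_spikeWeight (by omega) (by omega), ENNReal.ofReal_one])

/-- The weight of the scale `k + 1`, before normalization. -/
noncomputable def scaleWeight (B : ℝ) (k : ℕ) : ℝ := 1 / (((k : ℝ) + 1) * B ^ (k + 1))

theorem scaleWeight_pos {B : ℝ} (hB : 0 < B) (k : ℕ) : 0 < scaleWeight B k := by
  unfold scaleWeight; positivity

theorem sum_scaleWeight_pos {B : ℝ} (hB : 0 < B) {K : ℕ} (hK : 0 < K) :
    0 < ∑ k : Fin K, scaleWeight B k :=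
  Finset.sum_pos (fun k _ => scaleWeight_pos hB k) ⟨⟨0, hK⟩, Finset.mem_univ _⟩

/-- The distribution of the scale. -/
noncomputable def scalePMF {K : ℕ} (B : ℝ) (hB : 0 < B) (hK : 0 < K) : PMF (Fin K) :=
  PMF.ofFintype
    (fun k => ENNReal.ofReal (scaleWeight B k / ∑ j : Fin K, scaleWeight B j)) (by
    rw [← ENNReal.ofReal_sum_of_nonneg fun (k : Fin K) _ =>
        div_nonneg (scaleWeight_pos hB k).le (sum_scaleWeight_pos hB hK).le,
      ← Finset.sum_div, div_self (sum_scaleWeight_pos hB hK).ne', ENNReal.ofReal_one])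

/-- For a small spike probability `η / n` and a large number `K` of scales, no rule does
substantially better than in the secretary problem. -/
theorem exists_prior_reward_le {n K : ℕ} (hn : 1 ≤ n) (hK : 0 < K) {η : ℝ} (hη : 0 < η)
    (hη1 : η < 1) :
    ∃ (θ : Prior) (Z : ℝ), 0 < Z ∧
      ENNReal.ofReal (Z * ((∑ k ∈ Finset.Icc 1 K, 1 / (k : ℝ)) * (η * (1 - η)))) ≤
        expectedMax θ n ∧
      ∀ r : StoppingRule n, expectedReward θ r ≤
        ENNReal.ofReal (Z * ((∑ k ∈ Finset.Icc 1 K, 1 / (k : ℝ)) * (2 * η ^ 2) +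
          η / n * ((∑ k ∈ Finset.Icc 1 K, 1 / (k : ℝ) + 2 * n) * (n * Real.exp (-1) + 1)))) := by
  have hn1 : (1 : ℝ) ≤ n := by exact_mod_cast hn
  have hn0 : (0 : ℝ) < n := by linarith
  set H := ∑ k ∈ Finset.Icc 1 K, 1 / (k : ℝ) with hH
  set ε := η / n with hε
  have hnε : n * ε = η := by rw [hε]; field_simp
  have hε0 : 0 ≤ ε := by positivity
  have hε1 : ε ≤ 1 := by rw [hε, div_le_one hn0]; linarith
  -- With this ratio a value below the spike is worth at most `η ^ 2` of it, the same order as the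
  -- repeated-spike error `(n ε) ^ 2`; together they give `2 * η ^ 2`.
  set b : ℝ≥0 := ⟨1 / η ^ 2, by positivity⟩ with hb
  have hbη : (b : ℝ) = 1 / η ^ 2 := rfl
  have hη2 : η ^ 2 < 1 := pow_lt_one₀ hη.le hη1 (by norm_num)
  have hb1 : 1 < b := by
    rw [← NNReal.coe_lt_coe, hbη, NNReal.coe_one, lt_div_iff₀ (by positivity), one_mul]
    exact hη2
  have hb1' : (1 : ℝ) < b := by exact_mod_cast hb1
  have hb0' : (0 : ℝ) < b := by linarith
  set v : Fin (K + 1) → ℝ≥0 := fun a => b ^ (a : ℕ) with hv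
  have hvinj : Function.Injective v := fun a a' h =>
    Fin.ext (pow_right_injective₀ (by positivity) hb1.ne' h)
  set S := ∑ j : Fin K, scaleWeight b j with hS
  have hS0 : 0 < S := sum_scaleWeight_pos hb0' hK
  set κ := scalePMF (b : ℝ) hb0' hK
  set G := fun k : Fin K => spikePMF ε hε0 hε1 k
  set θ := mixturePrior κ G v
  have hp0 : ∀ k : Fin K, 0 ≤ scaleWeight b k / S := fun k =>
    div_nonneg (scaleWeight_pos hb0' k).le hS0.le
  have hval := expect_valueLaw_mixturePrior hvinj κ G (p := fun k => scaleWeight b k / S)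
    (w := fun k => spikeWeight (K + 1) (k + 1) ε) hp0
    (fun k a => spikeWeight_nonneg hε0 hε1 a) (fun k => rfl) (fun k a => rfl) n
  -- The prior cancels the size of the spike, leaving the weight `1 / k` at each scale (here `k +
  -- 1`) that the averaging argument needs.
  have hpV : ∀ (k : Fin K) (y : ℝ), scaleWeight b k / S * ((b : ℝ) ^ ((k : ℕ) + 1) * y) =
      1 / S * (y / ((k + 1 : ℕ) : ℝ)) := by
    intro k y
    unfold scaleWeight
    push_cast
    field_simp
  have hHfin : ∀ y : ℝ, ∑ k : Fin K, y / ((k + 1 : ℕ) : ℝ) = H * y := by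
    intro y
    rw [sum_fin_succ_eq_sum_Icc K fun k => y / (k : ℝ), hH, Finset.sum_mul]
    exact Finset.sum_congr rfl fun k _ => by ring
  refine ⟨θ, 1 / S, by positivity, ?_, fun r => ?_⟩
  · unfold expectedMax
    rw [hval]
    refine ENNReal.ofReal_le_ofReal ?_
    rw [← hHfin, Finset.mul_sum]
    refine Finset.sum_le_sum fun k _ => ?_
    rw [← hpV]
    refine mul_le_mul_of_nonneg_left ?_ (hp0 k)
    rw [← hnε]
    refine wsum_spike_max_ge hε0 hε1 (by omega) (by omega) (by positivity)
      (fun z => NNReal.coe_nonneg _) ?_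
    rintro z ⟨l, hl⟩
    have h1 : v (z l) ≤ Finset.univ.sup fun l => v (z l) :=
      Finset.le_sup (f := fun l => v (z l)) (Finset.mem_univ l)
    have h2 : v (z l) = b ^ ((k : ℕ) + 1) := by simp only [hv, hl]
    rw [h2] at h1
    exact_mod_cast h1
  · rw [expectedReward_eq_expect_rewardGiven, hval]
    refine ENNReal.ofReal_le_ofReal ?_
    set q : Fin n → (Fin n → Fin (K + 1)) → ℝ :=
      fun i z => r.timeWeight θ (fun l => v (z l)) i with hq
    have hq0 : ∀ i z, 0 ≤ q i z := fun i z => r.timeWeight_nonneg θ _ _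
    have hqs : ∀ z, ∑ i, q i z ≤ 1 := fun z => sum_timeWeight_coe_le r θ _
    have hqd : ∀ j, ∀ z z' : Fin n → Fin (K + 1), (∀ l ≤ j, z l = z' l) → q j z = q j z' :=
      fun j z z' h => timeWeight_congr r θ j fun l hl => by rw [h l hl]
    have hterm : ∀ k : Fin K, scaleWeight b k / S *
        wsum (fun _ : Fin n => spikeWeight (K + 1) (k + 1) ε)
          (fun z => (rewardGiven r θ (fun l => v (z l)) : ℝ)) ≤
        1 / S * (2 * η ^ 2 / ((k + 1 : ℕ) : ℝ) +
          ε * ((∑ i, acceptance (q i) i (k + 1)) / ((k + 1 : ℕ) : ℝ))) := by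
      intro k
      have hr := wsum_spike_reward_le (n := n) (N := K + 1) (k := k + 1) hε0 hε1 (by omega)
        (by omega) hq0 hqs hqd (v := fun a => (v a : ℝ)) (V := (b : ℝ) ^ ((k : ℕ) + 1))
        (c := η ^ 2) (by positivity) (by positivity)
        (by intro a ha; simp [hv, ha])
        (by
          intro a ha
          simp only [hv, NNReal.coe_pow]
          have h1 : (b : ℝ) ^ (a : ℕ) ≤ b ^ (k : ℕ) := pow_le_pow_right₀ hb1'.le (by omega)
          refine h1.trans_eq ?_
          have h2 : η ^ 2 * (b : ℝ) = 1 := by rw [hbη]; field_simp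
          rw [pow_succ' (b : ℝ), ← mul_assoc, h2, one_mul])
      simp_rw [coe_rewardGiven]
      refine (mul_le_mul_of_nonneg_left hr (hp0 k)).trans_eq ?_
      rw [hpV, hnε]
      ring
    refine (Finset.sum_le_sum fun k _ => hterm k).trans ?_
    rw [← Finset.mul_sum, Finset.sum_add_distrib, hHfin, ← Finset.mul_sum,
      sum_fin_succ_eq_sum_Icc K fun k => (∑ i, acceptance (q i) i k) / (k : ℝ)]
    have := sum_acceptance_fin_le hn hq0 hqs hqd
    gcongr

theorem exists_harmonic_ge (C : ℝ) :
    ∃ K : ℕ, 0 < K ∧ C ≤ ∑ k ∈ Finset.Icc 1 K, 1 / (k : ℝ) := by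
  have h := Real.tendsto_sum_range_one_div_nat_succ_atTop
  obtain ⟨K, hK, hK0⟩ := ((h.eventually_ge_atTop C).and (Filter.eventually_gt_atTop 0)).exists
  refine ⟨K, hK0, ?_⟩
  rw [← sum_fin_succ_eq_sum_Icc K fun k => 1 / (k : ℝ),
    Fin.sum_univ_eq_sum_range (fun k => 1 / ((k + 1 : ℕ) : ℝ))]
  push_cast
  exact hK

/-- The choice of parameters: the error terms are absorbed by `δ`. -/
theorem error_terms_le {δ η n H e : ℝ} (hη : 0 < η) (hηδ : η ≤ δ / 10) (hη1 : η ≤ 1 / 10)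
    (hn : 0 < n) (hnδ : 4 / δ ≤ n) (hδ : 0 < δ) (hH : 2 * n / η ≤ H) (he0 : 0 ≤ e)
    (he : e ≤ 2 / 5) :
    H * (2 * η ^ 2) + η / n * ((H + 2 * n) * (n * e + 1)) ≤
      (e + δ) * (H * (η * (1 - η))) := by
  have hHpos : 0 < H := lt_of_lt_of_le (by positivity) hH
  have h1 : 2 * n ≤ H * η := by rwa [div_le_iff₀ hη] at hH
  have h2 : n * e + 1 ≤ n * (e + δ / 4) := by
    rw [div_le_iff₀ hδ] at hnδ
    linarith
  have h3 : (H + 2 * n) * (n * e + 1) ≤ (H + H * η) * (n * (e + δ / 4)) := by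
    gcongr
  have h4 : η / n * ((H + 2 * n) * (n * e + 1)) ≤ η / n * ((H + H * η) * (n * (e + δ / 4))) := by
    gcongr
  have h5 : η / n * ((H + H * η) * (n * (e + δ / 4))) = H * η * ((1 + η) * (e + δ / 4)) := by
    field_simp
  -- This amounts to `2η + 2ηe + 5ηδ/4 ≤ 3δ/4`, whose left side is at most `0.405 δ`.
  have h6 : 2 * η + (1 + η) * (e + δ / 4) ≤ (e + δ) * (1 - η) := by
    have h7 := mul_le_mul_of_nonneg_left he hη.le
    have h8 := mul_le_mul_of_nonneg_right hη1 hδ.le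
    linarith
  have h9 := mul_le_mul_of_nonneg_left h6 (mul_pos hHpos hη).le
  calc _ ≤ H * (2 * η ^ 2) + H * η * ((1 + η) * (e + δ / 4)) := by linarith
    _ = H * η * (2 * η + (1 + η) * (e + δ / 4)) := by ring
    _ ≤ _ := h9
    _ = _ := by ring

end Prophet

theorem mainTheorem1 (δ : ℝ) (hδ : 0 < δ) :
    ∃ n₀ : ℕ, ∀ n : ℕ, n₀ ≤ n →
      ∃ θ : Prophet.Prior,
        0 < Prophet.expectedMax θ n ∧
        ∀ r : Prophet.StoppingRule n,
          Prophet.expectedReward θ r ≤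
            ENNReal.ofReal (1 / Real.exp 1 + δ) * Prophet.expectedMax θ n := by
  -- For `n ≥ 4 / δ` the additive `1` in the dual value is at most `n δ / 4`.
  obtain ⟨n₀, hn₀⟩ := exists_nat_ge (4 / δ)
  refine ⟨max n₀ 1, fun n hn => ?_⟩
  have hn1 : 1 ≤ n := (le_max_right _ _).trans hn
  have hn0 : (0 : ℝ) < n := by exact_mod_cast hn1
  have hnδ : 4 / δ ≤ n := hn₀.trans (by exact_mod_cast (le_max_left _ _).trans hn)
  set η := min (δ / 10) (1 / 10) with hη_def
  have hη : 0 < η := lt_min (by positivity) (by norm_num)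
  have hηδ : η ≤ δ / 10 := min_le_left _ _
  have hη1 : η ≤ 1 / 10 := min_le_right _ _
  -- The number of scales is chosen after `n` and `η`, so that the averaging error `2 n` is at most
  -- `η` times the harmonic sum.
  obtain ⟨K, hK, hH⟩ := Prophet.exists_harmonic_ge (2 * n / η)
  obtain ⟨θ, Z, hZ, hmax, hrew⟩ :=
    Prophet.exists_prior_reward_le hn1 hK hη (by linarith)
  have hHpos : 0 < ∑ k ∈ Finset.Icc 1 K, 1 / (k : ℝ) := lt_of_lt_of_le (by positivity) hH
  have hη' : 0 < 1 - η := by linarith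
  refine ⟨θ, lt_of_lt_of_le (ENNReal.ofReal_pos.2 (by positivity)) hmax, fun r => ?_⟩
  have he : Real.exp (-1) = 1 / Real.exp 1 := by rw [Real.exp_neg, one_div]
  have he25 : Real.exp (-1) ≤ 2 / 5 := by
    rw [he, div_le_iff₀ (Real.exp_pos _)]
    have := Real.exp_one_gt_d9
    linarith
  have herr := Prophet.error_terms_le hη hηδ hη1 hn0 hnδ hδ hH (Real.exp_pos (-1)).le he25
  refine (hrew r).trans ?_
  refine le_trans ?_ (mul_le_mul_right hmax _)
  rw [← ENNReal.ofReal_mul (by positivity), ← he]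
  refine ENNReal.ofReal_le_ofReal ?_
  have := mul_le_mul_of_nonneg_left herr hZ.le
  linarith
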